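/- All cohomology is taken with coefficients in $\mathbb{Z}_2$. Let $Y$ be a connected finite (CW) cell complex whose cells are enumerated as $\bar\sigma_1,\dots,\bar\sigma_K,\bar\sigma_\infty$, where $\bar\sigma_\infty$ is a $0$-cell, and suppose that $Y_k=\{\bar\sigma_{k+1},\dots,\bar\sigma_K,\bar\sigma_\infty\}$ is a subcomplex of $Y$ for every $0\le k\le K$ (so $Y_0=Y$ and $Y_K=\{\bar\sigma_\infty\}$). The indices are ordered by $1<2<\dots<K<\infty$. Let $\tilde H^0(Y_k)$ be the quotient of $Z^0(Y_k)=\ker(\delta:C^0(Y_k)\to C^1(Y_k))$ by the line spanned by $\sum_{\bar\sigma}\bar\sigma^*$, the sum over all $0$-cells of $Y_k$. The restriction maps $\tilde H^0(Y_0)\to\tilde H^0(Y_1)\to\dots\to\tilde H^0(Y_K)$ form the reduced $0$th persistent cohomology $\tilde H^0(\mathbb{Y})$, indexed by $T=\{0,\dots,K\}$. Its persistence diagram $\tilde D^0(\mathbb{Y})$ is the multiset of pairs $(b,d)$ with $b\in T$, $d\in T\cup\{\infty\}$, $b<d$, such that $\tilde H^0(\mathbb{Y})\cong\bigoplus_{(b,d)\in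 \tilde D^0(\mathbb{Y})}I(b,d)$, where $I(b,d)$ is the interval module that is $\mathbb{Z}_2$ at the indices $t$ with $b\le t<d$ (with identity maps between them) and $0$ elsewhere. Define directed graphs $(V_k,E_k)$ for $k=K,K-1,\dots,0$, whose nodes are $0$-cells and whose edges carry an integer label, by the merge-tree algorithm. Start with $V_K=\{\bar\sigma_\infty\}$ and $E_K=\emptyset$. For $k=K,\dots,1$: * if $\bar\sigma_k$ is a $0$-cell, put $V_{k-1}=V_k\cup\{\bar\sigma_k\}$ and $E_{k-1}=E_k$; * if $\bar\sigma_k$ is a $1$-cell with endpoints $\bar\sigma_s,\bar\sigma_t$, let $\bar\sigma_{s'},\bar\sigma_{t'}$ be the roots reached from $\bar\sigma_s,\bar\sigma_t$ by following edges of $E_k$ as long as possible. Put $V_{k-1}=V_k$, and put $E_{k-1}=E_k$ if $s'=t'$, $E_{k-1}=E_k\cup\{(\bar\sigma_{t'}\xrightarrow{k}\bar\sigma_{s'})\}$ if $s'>t'$, and $E_{k-1}=E_k\cup\{(\bar\sigma_{s'}\xrightarrow{k}\bar\sigma_{t'})\}$ if $s'<t'$; * otherwise put $V_{k-1}=V_k$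 and $E_{k-1}=E_k$. Then the persistence diagram $\tilde D^0(\mathbb{Y})$ exists, is unique, and is given by $$\tilde D^0(\mathbb{Y})=\{(k,s)\mid(\bar\sigma_s\xrightarrow{k}\bar\sigma_t)\in E_0 \text{ for some } t\},$$ each pair having multiplicity one. -/

import Mathlib

/-! ## Persistence modules, interval modules and persistence diagrams -/

namespace MergeTree

universe u v w

/-- A persistence module over the field `𝕜` indexed by the ordered set `T`: vector spaces `obj t`
and linear maps `map : obj s → obj t` for `s ≤ t`, functorial in `s ≤ t`. -/
structure PersistenceModule (𝕜 : Type u) [Field 𝕜] (T : Type v) [Preorder T] where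
  /-- The vector space at `t`. -/
  obj : T → Type w
  [addCommGroup : ∀ t, AddCommGroup (obj t)]
  [module : ∀ t, Module 𝕜 (obj t)]
  /-- The structure maps. -/
  map : ∀ {s t : T}, s ≤ t → obj s →ₗ[𝕜] obj t
  map_refl : ∀ (t : T) (x : obj t), map (le_refl t) x = x
  map_trans : ∀ {s t r : T} (hst : s ≤ t) (htr : t ≤ r) (x : obj s),
    map htr (map hst x) = map (hst.trans htr) x

attribute [instance] PersistenceModule.addCommGroup PersistenceModule.module

namespace PersistenceModule

variable {𝕜 : Type u} [Field 𝕜] {T : Type v} [Preorder T]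

/-- Two persistence modules are isomorphic if there are linear equivalences at every index that
commute with the structure maps. -/
def Isomorphic (M : PersistenceModule.{u, v, w} 𝕜 T) (N : PersistenceModule.{u, v, u} 𝕜 T) :
    Prop :=
  ∃ e : ∀ t, M.obj t ≃ₗ[𝕜] N.obj t,
    ∀ (s t : T) (h : s ≤ t) (x : M.obj s), e t (M.map h x) = N.map h (e s x)

open Classical in
/-- The interval module `I(b, d)`, with `b ∈ T` and `d ∈ T ∪ {∞}`. Its space at `t` is `𝕜` when
`b ≤ t < d` and `0` otherwise (the functions to `𝕜` from a type with one element, respectively no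
element), and its structure map from `s` to `t` is the identity of `𝕜` when `b ≤ s ≤ t < d` and
`0` otherwise. -/
noncomputable def interval (𝕜 : Type u) [Field 𝕜] {T : Type v} [Preorder T] (b : T) (d : WithTop T) :
    PersistenceModule.{u, v, u} 𝕜 T where
  obj t := PLift (b ≤ t ∧ (t : WithTop T) < d) → 𝕜
  map {s _} _ :=
    { toFun := fun f _ => if h : b ≤ s ∧ (s : WithTop T) < d then f ⟨h⟩ else 0
      map_add' := by
        intro f g; ext _; by_cases h : b ≤ s ∧ (s : WithTop T) < d <;> simp [h]
      map_smul' := by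
        intro c f; ext _; by_cases h : b ≤ s ∧ (s : WithTop T) < d <;> simp [h] }
  map_refl t f := by
    ext ⟨h⟩
    simp [h]
  map_trans {s t r} hst htr f := by
    ext ⟨h⟩
    by_cases hs : b ≤ s ∧ (s : WithTop T) < d
    · have ht : b ≤ t ∧ (t : WithTop T) < d :=
        ⟨hs.1.trans hst, lt_of_le_of_lt (WithTop.coe_le_coe.mpr htr) h.2⟩
      simp [hs, ht]
    · simp [hs]

/-- The direct sum of a finite family of persistence modules. -/
def directSum {ι : Type} [Finite ι] (M : ι → PersistenceModule.{u, v, w} 𝕜 T) :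
    PersistenceModule.{u, v, w} 𝕜 T where
  obj t := ∀ i, (M i).obj t
  map h := LinearMap.pi fun i => (M i).map h ∘ₗ LinearMap.proj i
  map_refl t x := by
    ext i
    simp [(M i).map_refl]
  map_trans hst htr x := by
    ext i
    simp [(M i).map_trans]

/-- The multiset `D` of birth-death pairs `(b, d)`, with `b ∈ T`, `d ∈ T ∪ {∞}` and `b < d`, is a
persistence diagram of `M` if `M` is isomorphic to the direct sum of the interval modules
`I(b, d)`, `(b, d) ∈ D`. -/
def IsDiagram (M : PersistenceModule.{u, v, w} 𝕜 T) (D : Multiset (T × WithTop T)) : Prop :=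
  ∃ (p : ℕ) (b : Fin p → T) (d : Fin p → WithTop T),
    (∀ i, (b i : WithTop T) < d i) ∧
    D = Finset.univ.val.map (fun i => (b i, d i)) ∧
    M.Isomorphic (directSum fun i => interval 𝕜 (b i) (d i))

end PersistenceModule

/-! ## Reduced cellular cohomology in degree `0` with coefficients in `ℤ/2` -/

section Cohomology

open Topology Topology.CWComplex

variable {X : Type u} [TopologicalSpace X] {C : Set X} [CWComplex C]

/-- The characteristic map of a `1`-cell sends the two boundary points `±1` of `[-1, 1]` to
`0`-cells. -/
theorem exists_vertex (e : cell C 1) (x : Fin 1 → ℝ) (hx : x ∈ Metric.sphere (0 : Fin 1 → ℝ) 1) :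
    ∃ v : cell C 0, map 0 v 0 = map 1 e x := by
  obtain ⟨I, hI⟩ := CWComplex.mapsTo (C := C) 1 e
  have h := hI hx
  simp only [Set.mem_iUnion] at h
  obtain ⟨m, hm, j, -, y, -, hy⟩ := h
  obtain rfl : m = 0 := by omega
  exact ⟨j, by rw [← hy, Subsingleton.elim y 0]⟩

theorem one_mem_sphere : (fun _ => 1 : Fin 1 → ℝ) ∈ Metric.sphere (0 : Fin 1 → ℝ) 1 := by
  simp [Pi.norm_def]

theorem neg_one_mem_sphere : (fun _ => -1 : Fin 1 → ℝ) ∈ Metric.sphere (0 : Fin 1 → ℝ) 1 := by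
  simp [Pi.norm_def]

/-- The first endpoint of a `1`-cell: the `0`-cell at the image of `-1`. -/
noncomputable def tail (e : cell C 1) : cell C 0 :=
  (exists_vertex e _ neg_one_mem_sphere).choose

/-- The second endpoint of a `1`-cell: the `0`-cell at the image of `1`. -/
noncomputable def head (e : cell C 1) : cell C 0 :=
  (exists_vertex e _ one_mem_sphere).choose

theorem map_tail (e : cell C 1) : map 0 (tail e) 0 = map 1 e (fun _ => -1) :=
  (exists_vertex e _ neg_one_mem_sphere).choose_spec

theorem map_head (e : cell C 1) : map 0 (head e) 0 = map 1 e (fun _ => 1) :=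
  (exists_vertex e _ one_mem_sphere).choose_spec

variable [T2Space X]

theorem vertex_mem (E : Subcomplex C) {e : cell C 1} (he : e ∈ E.I 1) {x : Fin 1 → ℝ}
    (hx : x ∈ Metric.sphere (0 : Fin 1 → ℝ) 1) {v : cell C 0} (hv : map 0 v 0 = map 1 e x) :
    v ∈ E.I 0 := by
  by_contra hn
  have hd := RelCWComplex.Subcomplex.disjoint_openCell_subcomplex_of_not_mem E hn
  refine Set.disjoint_left.mp hd (RelCWComplex.map_zero_mem_openCell 0 v) ?_
  rw [hv]
  exact RelCWComplex.Subcomplex.closedCell_subset_of_mem E he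
    (Set.mem_image_of_mem _ (Metric.sphere_subset_closedBall hx))

theorem tail_mem (E : Subcomplex C) {e : cell C 1} (he : e ∈ E.I 1) : tail e ∈ E.I 0 :=
  vertex_mem E he neg_one_mem_sphere (map_tail e)

theorem head_mem (E : Subcomplex C) {e : cell C 1} (he : e ∈ E.I 1) : head e ∈ E.I 0 :=
  vertex_mem E he one_mem_sphere (map_head e)

/-- The cellular cochains `Cⁿ(E; ℤ/2)` of a subcomplex `E`: functions on its `n`-cells. -/
abbrev Cochain (E : Subcomplex C) (n : ℕ) : Type u := E.I n → ZMod 2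

/-- The coboundary operator `δ : C⁰(E) → C¹(E)`, the transpose of `∂e = head e - tail e`. -/
noncomputable def coboundary (E : Subcomplex C) : Cochain E 0 →ₗ[ZMod 2] Cochain E 1 where
  toFun f e := f ⟨head e.1, head_mem E e.2⟩ - f ⟨tail e.1, tail_mem E e.2⟩
  map_add' f g := by ext e; simp only [Pi.add_apply]; ring
  map_smul' c f := by ext e; simp only [Pi.smul_apply, smul_eq_mul, RingHom.id_apply]; ring

/-- The augmentation `ℤ/2 → C⁰(E)`, which sends `1` to the sum of the dual basis vectors of all
`0`-cells, that is, to the constant cochain `1`. -/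
def augmentation (E : Subcomplex C) : ZMod 2 →ₗ[ZMod 2] Cochain E 0 where
  toFun c _ := c
  map_add' _ _ := rfl
  map_smul' _ _ := rfl

/-- The cocycles `Z⁰(E) = ker (δ : C⁰(E) → C¹(E))`. -/
noncomputable abbrev Cocycle (E : Subcomplex C) : Submodule (ZMod 2) (Cochain E 0) :=
  LinearMap.ker (coboundary E)

/-- The reduced cohomology `H̃⁰(E; ℤ/2)`: the quotient of `Z⁰(E)` by the image of the
augmentation. -/
abbrev ReducedCohomology (E : Subcomplex C) : Type u :=
  Cocycle E ⧸ (LinearMap.range (augmentation E)).submoduleOf (Cocycle E)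

/-- The map `C⁰(E) → C⁰(E')` induced by the inclusion of a subcomplex `E'` of `E`: the restriction
of functions. -/
def restrictCochain {E E' : Subcomplex C} (h : ∀ n, E'.I n ⊆ E.I n) :
    Cochain E 0 →ₗ[ZMod 2] Cochain E' 0 where
  toFun f v := f ⟨v.1, h 0 v.2⟩
  map_add' _ _ := rfl
  map_smul' _ _ := rfl

theorem restrictCochain_mem {E E' : Subcomplex C} (h : ∀ n, E'.I n ⊆ E.I n) :
    ∀ f ∈ Cocycle E, restrictCochain h f ∈ Cocycle E' := by
  intro f hf
  rw [LinearMap.mem_ker] at hf ⊢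
  ext e
  exact congrFun hf ⟨e.1, h 1 e.2⟩

/-- The map `H̃⁰(E) → H̃⁰(E')` induced by the inclusion of a subcomplex `E'` of `E`. -/
noncomputable def restrictCohomology {E E' : Subcomplex C} (h : ∀ n, E'.I n ⊆ E.I n) :
    ReducedCohomology E →ₗ[ZMod 2] ReducedCohomology E' :=
  Submodule.mapQ _ _ ((restrictCochain h).restrict (restrictCochain_mem h)) (by
    rintro ⟨f, hf⟩ ⟨c, hc⟩
    exact ⟨c, by ext v; exact congrFun hc ⟨v.1, h 0 v.2⟩⟩)

/-! ## The filtration -/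

/-- The index set `{1, …, K, ∞}` of the cells, as a subset of `{0, …, K} ∪ {∞}`. -/
abbrev CellIndex (K : ℕ) : Type := {i : WithTop (Fin (K + 1)) // i ≠ 0}

/-- The index `∞`. -/
def CellIndex.infty (K : ℕ) : CellIndex K := ⟨⊤, WithTop.top_ne_coe⟩

/-- The index `i + 1` with `i ∈ {0, …, K - 1}`. -/
def CellIndex.succ {K : ℕ} (i : Fin K) : CellIndex K :=
  ⟨(i.succ : WithTop (Fin (K + 1))), fun h => Fin.succ_ne_zero i (WithTop.coe_injective h)⟩

/-- A connected cell complex `Y` whose cells are enumerated as `σ_1, …, σ_K, σ_∞`, such that `σ_∞`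
is a `0`-cell and `Y_k = {σ_{k+1}, …, σ_K, σ_∞}` is a subcomplex for every `0 ≤ k ≤ K`. -/
structure CellFiltration {X : Type u} [TopologicalSpace X] [T2Space X] (Y : Set X) [CWComplex Y]
    (K : ℕ) where
  /-- The enumeration of the cells of all dimensions. -/
  cellAt : CellIndex K ≃ (n : ℕ) × cell Y n
  /-- `σ_∞` is a `0`-cell. -/
  dim_infty : (cellAt (CellIndex.infty K)).1 = 0
  /-- The subcomplex `Y_k`. -/
  sub : Fin (K + 1) → Subcomplex Y
  /-- The cells of `Y_k` are those with index greater than `k`. -/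
  mem_sub : ∀ (k : Fin (K + 1)) (n : ℕ) (c : cell Y n),
    c ∈ (sub k).I n ↔ (k : WithTop (Fin (K + 1))) < (cellAt.symm ⟨n, c⟩).1
  /-- `Y` is connected. -/
  connected : IsConnected Y

namespace CellFiltration

variable {K : ℕ} (F : CellFiltration C K)

theorem sub_anti {j k : Fin (K + 1)} (h : j ≤ k) (n : ℕ) : (F.sub k).I n ⊆ (F.sub j).I n := by
  intro c hc
  rw [F.mem_sub] at hc ⊢
  exact lt_of_le_of_lt (WithTop.coe_le_coe.mpr h) hc

/-- The reduced `0`th persistent cohomology `H̃⁰(Y_0) → H̃⁰(Y_1) → ⋯ → H̃⁰(Y_K)`. -/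
noncomputable def reducedPersistentCohomology :
    PersistenceModule.{0, 0, u} (ZMod 2) (Fin (K + 1)) where
  obj k := ReducedCohomology (F.sub k)
  map h := restrictCohomology (F.sub_anti h)
  map_refl t x := by
    obtain ⟨x, rfl⟩ := Submodule.Quotient.mk_surjective _ x
    rfl
  map_trans hst htr x := by
    obtain ⟨x, rfl⟩ := Submodule.Quotient.mk_surjective _ x
    rfl

end CellFiltration

end Cohomology

/-! ## The merge-tree algorithm -/

/-- A directed edge `source ⟶ target` with the extra data `label`. A `0`-cell is represented by its
index. -/
structure Edge (K : ℕ) where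
  source : CellIndex K
  label : Fin (K + 1)
  target : CellIndex K

/-- A directed graph whose nodes are `0`-cells and whose edges carry labels. -/
structure Graph (K : ℕ) where
  nodes : Finset (CellIndex K)
  edges : Finset (Edge K)

open Classical in
/-- Follow an edge that starts at `x`, or stay at `x` if there is none. -/
noncomputable def follow {K : ℕ} (G : Graph K) (x : CellIndex K) : CellIndex K :=
  if h : ∃ e ∈ G.edges, e.source = x then h.choose.target else x

/-- The procedure `Root(x, V, E)`: follow edges from `x` recursively. In a directed forest every
path has at most as many steps as there are edges, so after that many steps the root is reached. -/
noncomputable def root {K : ℕ} (G : Graph K) (x : CellIndex K) : CellIndex K :=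
  (follow G)^[G.edges.card] x

namespace CellFiltration

open Topology Topology.CWComplex

variable {X : Type u} [TopologicalSpace X] [T2Space X] {C : Set X} [CWComplex C] {K : ℕ}
  (F : CellFiltration C K)

open Classical in
/-- The body of the loop for `k = i + 1`: it computes `(V_{k-1}, E_{k-1})` from
`G = (V_k, E_k)`. -/
noncomputable def step (i : Fin K) (G : Graph K) : Graph K :=
  match F.cellAt (CellIndex.succ i) with
  | ⟨0, _⟩ => ⟨insert (CellIndex.succ i) G.nodes, G.edges⟩
  | ⟨1, e⟩ =>
    let s' := root G (F.cellAt.symm ⟨0, tail e⟩)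
    let t' := root G (F.cellAt.symm ⟨0, head e⟩)
    if s' = t' then G
    else if s' > t' then ⟨G.nodes, insert ⟨t', i.succ, s'⟩ G.edges⟩
    else ⟨G.nodes, insert ⟨s', i.succ, t'⟩ G.edges⟩
  | ⟨_ + 2, _⟩ => G

/-- The graph `(V_k, E_k)` of the merge-tree algorithm, for `k = K, K - 1, …, 0`. -/
noncomputable def mergeTree (k : Fin (K + 1)) : Graph K :=
  Fin.reverseInduction (motive := fun _ => Graph K) ⟨{CellIndex.infty K}, ∅⟩ (fun i G => F.step i G) k

end CellFiltration

end MergeTree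

/-! A `0`-cocycle of `Y_k` is a function on the vertices of `Y_k` that agrees at the two ends of
every `1`-cell of `Y_k`. The edges of `E_0` with label above `k` impose exactly the same equalities
as these `1`-cells; this is the invariant `IsMergeForest` combined with `mem_mergeTree_edges_iff`.
Edges point to larger indices and every node has at most one outgoing edge, so `E_0` is a forest.
Since `Y` is connected, every vertex other than `σ_∞` has an outgoing edge (`exists_edge`), so `E_0`
is a tree rooted at `σ_∞`. Hence a function on the vertices of `Y_k`, modulo constants, amounts to
an arbitrary choice of differences along the edges with source in `Y_k`, and it is a cocycle iff the
differences on edges with label above `k` vanish. The remaining coordinates are the edges with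
`label ≤ k < source`, that is, the intervals `I(label, source)` alive at `k` (`ker_differences`,
`differences_surjective`). Restriction preserves differences, so these isomorphisms form one of
persistence modules (`isomorphic_edgeIntervals`). Uniqueness holds because the ranks of the
structure maps count the intervals containing both indices, and these counts determine the multiset
(`eq_of_countP_eq`). -/

namespace MergeTree

universe u v w

/-! ### Uniqueness of persistence diagrams, by rank counting. -/

namespace PersistenceModule

section Uniqueness

variable {𝕜 : Type u} [Field 𝕜] {T : Type v} [PartialOrder T]

open Classical in
theorem directSum_interval_map_apply {ι : Type} [Finite ι] (b : ι → T) (d : ι → WithTop T)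
    {s t : T} (h : s ≤ t) (x : (directSum fun i => interval 𝕜 (b i) (d i)).obj s) (i : ι)
    (ht : PLift (b i ≤ t ∧ (t : WithTop T) < d i)) :
    (directSum fun i => interval 𝕜 (b i) (d i)).map h x i ht =
      if hs : b i ≤ s ∧ (s : WithTop T) < d i then x i ⟨hs⟩ else 0 :=
  rfl

open Classical in
/-- The rank of a structure map of a direct sum of interval modules counts the intervals that
contain both indices. -/
theorem finrank_range_map_directSum_interval {p : ℕ} (b : Fin p → T) (d : Fin p → WithTop T)
    {s t : T} (h : s ≤ t) :
    Module.finrank 𝕜 (LinearMap.range ((directSum fun i => interval 𝕜 (b i) (d i)).map h)) =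
      Fintype.card {i // b i ≤ s ∧ (t : WithTop T) < d i} := by
  have hs : ∀ i : {i // b i ≤ s ∧ (t : WithTop T) < d i}, b i ≤ s ∧ (s : WithTop T) < d i :=
    fun i => ⟨i.2.1, lt_of_le_of_lt (WithTop.coe_le_coe.mpr h) i.2.2⟩
  -- `L` keeps the coordinates of the intervals that survive from `s` to `t`. It is surjective with
  -- the same kernel as the structure map, so both have the same rank.
  let L : (directSum fun i => interval 𝕜 (b i) (d i)).obj s →ₗ[𝕜]
      ({i // b i ≤ s ∧ (t : WithTop T) < d i} → 𝕜) :=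
    { toFun := fun x i => x i.1 ⟨hs i⟩
      map_add' := fun _ _ => rfl
      map_smul' := fun _ _ => rfl }
  have hL : Function.Surjective L := by
    intro c
    refine ⟨fun i _ => if hi : b i ≤ s ∧ (t : WithTop T) < d i then c ⟨i, hi⟩ else 0, ?_⟩
    ext i
    exact dif_pos i.2
  have hker : LinearMap.ker ((directSum fun i => interval 𝕜 (b i) (d i)).map h) =
      LinearMap.ker L := by
    apply le_antisymm
    · intro x hx
      rw [LinearMap.mem_ker] at hx ⊢
      ext i
      have h1 := directSum_interval_map_apply b d h x i.1 ⟨i.2.1.trans h, i.2.2⟩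
      rw [hx, dif_pos (hs i)] at h1
      exact h1.symm
    · intro x hx
      rw [LinearMap.mem_ker] at hx ⊢
      funext i hi
      rw [directSum_interval_map_apply]
      split_ifs with h2
      · exact congrFun hx ⟨i, h2.1, hi.down.2⟩
      · rfl
  have e := ((LinearMap.quotKerEquivRange
    ((directSum fun i => interval 𝕜 (b i) (d i)).map h)).symm.trans
      (Submodule.quotEquivOfEq _ _ hker)).trans (L.quotKerEquivOfSurjective hL)
  rw [e.finrank_eq, Module.finrank_fintype_fun_eq_card]

theorem Isomorphic.finrank_range_map {M : PersistenceModule.{u, v, w} 𝕜 T}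
    {N : PersistenceModule.{u, v, u} 𝕜 T} (h : M.Isomorphic N) {s t : T} (hst : s ≤ t) :
    Module.finrank 𝕜 (LinearMap.range (M.map hst)) =
      Module.finrank 𝕜 (LinearMap.range (N.map hst)) := by
  obtain ⟨e, he⟩ := h
  have : LinearMap.range (N.map hst) =
      (LinearMap.range (M.map hst)).map (e t : M.obj t →ₗ[𝕜] N.obj t) := by
    rw [← LinearMap.range_comp,
      ← LinearMap.range_comp_of_range_eq_top (N.map hst) (LinearEquiv.range (e s))]
    congr 1
    ext x
    exact (he s t hst x).symm
  rw [this]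
  exact (LinearEquiv.finrank_map_eq (e t) _).symm

open Classical in
theorem IsDiagram.finrank_range_map {M : PersistenceModule.{u, v, w} 𝕜 T}
    {D : Multiset (T × WithTop T)} (h : M.IsDiagram D) {s t : T} (hst : s ≤ t) :
    Module.finrank 𝕜 (LinearMap.range (M.map hst)) =
      D.countP fun x => x.1 ≤ s ∧ (t : WithTop T) < x.2 := by
  obtain ⟨p, b, d, -, rfl, hM⟩ := h
  rw [hM.finrank_range_map, finrank_range_map_directSum_interval, Multiset.countP_map,
    Fintype.card_subtype]
  rfl

theorem IsDiagram.lt {M : PersistenceModule.{u, v, w} 𝕜 T} {D : Multiset (T × WithTop T)}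
    (h : M.IsDiagram D) {x : T × WithTop T} (hx : x ∈ D) : (x.1 : WithTop T) < x.2 := by
  obtain ⟨p, b, d, hbd, rfl, -⟩ := h
  obtain ⟨i, -, rfl⟩ := Multiset.mem_map.mp hx
  exact hbd i

/-- Every `d ∈ {0, …, K} ∪ {∞}` above some index has an immediate predecessor. -/
theorem exists_pred {K : ℕ} {b : Fin (K + 1)} {d : WithTop (Fin (K + 1))}
    (h : (b : WithTop (Fin (K + 1))) < d) :
    ∃ t, b ≤ t ∧ ∀ x : WithTop (Fin (K + 1)), d ≤ x ↔ (t : WithTop (Fin (K + 1))) < x := by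
  induction d using WithTop.recTopCoe with
  | top =>
    refine ⟨Fin.last K, Fin.le_last b, fun x => ?_⟩
    induction x using WithTop.recTopCoe with
    | top => simp
    | coe x => simp [Fin.le_last x]
  | coe d =>
    rw [WithTop.coe_lt_coe] at h
    obtain ⟨i, rfl⟩ := Fin.exists_succ_eq.mpr (Fin.ne_zero_of_lt h)
    refine ⟨i.castSucc, by rwa [Fin.le_castSucc_iff], fun x => ?_⟩
    induction x using WithTop.recTopCoe with
    | top => simp
    | coe x => simp [Fin.castSucc_lt_iff_succ_le]

open Classical in
/-- A multiset of pairs `b < d` is determined by the numbers of its elements `(b, d)` with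
`b ≤ s ≤ t < d`. -/
theorem eq_of_countP_eq {K : ℕ} {D D' : Multiset (Fin (K + 1) × WithTop (Fin (K + 1)))}
    (hD : ∀ x ∈ D, (x.1 : WithTop (Fin (K + 1))) < x.2)
    (hD' : ∀ x ∈ D', (x.1 : WithTop (Fin (K + 1))) < x.2)
    (h : ∀ s t : Fin (K + 1), s ≤ t →
      D.countP (fun x => x.1 ≤ s ∧ (t : WithTop (Fin (K + 1))) < x.2) =
        D'.countP (fun x => x.1 ≤ s ∧ (t : WithTop (Fin (K + 1))) < x.2)) :
    D = D' := by
  -- Intervals are ordered by reverse inclusion: below `(b, d)` are the pairs with earlier birth and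
  -- later death. The multiplicity of `(b, d)` is then the count of intervals containing it minus
  -- multiplicities already known.
  let r : Fin (K + 1) × (WithTop (Fin (K + 1)))ᵒᵈ → Fin (K + 1) × (WithTop (Fin (K + 1)))ᵒᵈ → Prop :=
    (· < ·)
  have hr : WellFounded r := Finite.wellFounded_of_trans_of_irrefl _
  have key : ∀ y : Fin (K + 1) × (WithTop (Fin (K + 1)))ᵒᵈ,
      D.count (y.1, OrderDual.ofDual y.2) = D'.count (y.1, OrderDual.ofDual y.2) := by
    intro y
    induction y using hr.induction with
    | _ y ih =>
    obtain ⟨b, d⟩ := y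
    induction d using OrderDual.rec with
    | _ d =>
    simp only [OrderDual.ofDual_toDual]
    by_cases hbd : (b : WithTop (Fin (K + 1))) < d
    · obtain ⟨t, hbt, ht⟩ := exists_pred hbd
      have h1 := h b t hbt
      simp only [← ht] at h1
      have split : ∀ E : Multiset (Fin (K + 1) × WithTop (Fin (K + 1))),
          E.countP (fun x => x.1 ≤ b ∧ d ≤ x.2) = E.count (b, d) +
            Multiset.card (E.filter fun x => (x.1 ≤ b ∧ d ≤ x.2) ∧ ¬ x = (b, d)) := by
        intro E
        rw [Multiset.countP_eq_countP_filter_add _ _ (fun x => x = (b, d)), Multiset.countP_filter,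
          Multiset.countP_filter, ← Multiset.countP_eq_card_filter, Multiset.count]
        congr 1
        refine Multiset.countP_congr rfl fun x _ => ?_
        refine propext ⟨fun hx => hx.2.symm, ?_⟩
        rintro rfl
        exact ⟨⟨le_rfl, le_rfl⟩, rfl⟩
      have h2 : (D.filter fun x => (x.1 ≤ b ∧ d ≤ x.2) ∧ ¬ x = (b, d)) =
          D'.filter fun x => (x.1 ≤ b ∧ d ≤ x.2) ∧ ¬ x = (b, d) := by
        ext ⟨b', d'⟩
        rw [Multiset.count_filter, Multiset.count_filter]
        split_ifs with hx
        · refine ih (b', OrderDual.toDual d') (lt_of_le_of_ne ⟨hx.1.1, hx.1.2⟩ ?_)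
          intro he
          exact hx.2 he
        · rfl
      rw [split, split, h2] at h1
      omega
    · rw [Multiset.count_eq_zero_of_notMem fun hm => hbd (hD _ hm),
        Multiset.count_eq_zero_of_notMem fun hm => hbd (hD' _ hm)]
  ext ⟨b, d⟩
  exact key (b, OrderDual.toDual d)

/-- Persistence diagrams are unique. -/
theorem IsDiagram.unique {K : ℕ} {M : PersistenceModule.{u, 0, w} 𝕜 (Fin (K + 1))}
    {D D' : Multiset (Fin (K + 1) × WithTop (Fin (K + 1)))} (h : M.IsDiagram D)
    (h' : M.IsDiagram D') : D = D' := by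
  classical
  refine eq_of_countP_eq (fun x hx => h.lt hx) (fun x hx => h'.lt hx) fun s t hst => ?_
  convert (h.finrank_range_map hst).symm.trans (h'.finrank_range_map hst)

end Uniqueness

end PersistenceModule


/-! ### From topological connectedness to connectedness of the `1`-skeleton. -/

section Connectedness

open Topology Topology.CWComplex

variable {X : Type u} [TopologicalSpace X] {C : Set X} [CWComplex C]

theorem cellFrontier_one_eq_tail_head (e : cell C 1) :
    cellFrontier 1 e = {map 0 (tail e) 0, map 0 (head e) 0} := by
  rw [RelCWComplex.cellFrontier_one_eq, map_tail, map_head, Set.image_pair]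
  rfl

/-- The frontier is a continuous image of the unit sphere of `Fin n → ℝ`, which is connected once
the dimension exceeds `1`. Such cells therefore cannot join two separated pieces. -/
theorem isPreconnected_cellFrontier {n : ℕ} (hn : 2 ≤ n) (e : cell C n) :
    IsPreconnected (cellFrontier n e) := by
  refine (isPreconnected_sphere ?_ _ _).image _
    ((continuousOn n e).mono Metric.sphere_subset_closedBall)
  rw [rank_fin_fun]
  exact_mod_cast hn

theorem disjoint_cellFrontier_openCell (n : ℕ) (e : cell C n) :
    Disjoint (cellFrontier n e) (openCell n e) := by
  obtain ⟨I, hI⟩ := CWComplex.cellFrontier_subset_finite_openCell n e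
  refine Set.disjoint_of_subset_left hI ?_
  simp only [Set.disjoint_iUnion_left]
  intro m hm j _
  exact RelCWComplex.disjoint_openCell_of_ne fun h => hm.ne (congrArg Sigma.fst h)

/-- `Z` is the disjoint union of two closed sets that contain the `0`-cells in `S`, respectively
outside `S`. -/
def SeparatedBy (S : Set (cell C 0)) (Z : Set X) : Prop :=
  ∃ A B : Set X, IsClosed A ∧ IsClosed B ∧ Disjoint A B ∧ A ∪ B = Z ∧
    ∀ v : cell C 0, map 0 v 0 ∈ Z → (v ∈ S → map 0 v 0 ∈ A) ∧ (v ∉ S → map 0 v 0 ∈ B)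

theorem SeparatedBy.compl {S : Set (cell C 0)} {Z : Set X} (h : SeparatedBy S Z) :
    SeparatedBy Sᶜ Z := by
  obtain ⟨A, B, hA, hB, hAB, rfl, hv⟩ := h
  exact ⟨B, A, hB, hA, hAB.symm, Set.union_comm _ _, fun v h => ⟨(hv v h).2, fun hn =>
    (hv v h).1 (not_not.mp hn)⟩⟩

theorem zero_cell_eq_of_mem_openCell {n : ℕ} {e : cell C n} {v : cell C 0}
    (h : map 0 v 0 ∈ openCell n e) : (⟨0, v⟩ : (n : ℕ) × cell C n) = ⟨n, e⟩ := by
  by_contra hne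
  exact Set.disjoint_left.mp (RelCWComplex.disjoint_openCell_of_ne hne)
    (RelCWComplex.map_zero_mem_openCell 0 v) h

theorem Subcomplex.eq_union_openCell {E E' : Subcomplex C} {n : ℕ} {e : cell C n}
    (h : ∀ (m : ℕ) (c : cell C m),
      c ∈ E.I m ↔ c ∈ E'.I m ∨ ((⟨m, c⟩ : (n : ℕ) × cell C n) = ⟨n, e⟩)) :
    (E : Set X) = (E' : Set X) ∪ openCell n e := by
  rw [← CWComplex.Subcomplex.union, ← CWComplex.Subcomplex.union (E := E')]
  apply Set.Subset.antisymm
  · simp only [Set.iUnion_subset_iff]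
    rintro m ⟨c, hc⟩
    obtain hc | hc := (h m c).mp hc
    · exact fun x hx => Or.inl (Set.mem_iUnion₂.mpr ⟨m, ⟨c, hc⟩, hx⟩)
    · cases hc
      exact Set.subset_union_right
  · apply Set.union_subset
    · simp only [Set.iUnion_subset_iff]
      rintro m ⟨c, hc⟩
      exact fun x hx => Set.mem_iUnion₂.mpr ⟨m, ⟨c, (h m c).mpr (Or.inl hc)⟩, hx⟩
    · exact fun x hx => Set.mem_iUnion₂.mpr ⟨n, ⟨e, (h n e).mpr (Or.inr rfl)⟩, hx⟩

variable [T2Space X]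

/-- A separation extends over a cell whose frontier lies in one of the two parts. -/
theorem SeparatedBy.attach {S : Set (cell C 0)} {A B : Set X} (hA : IsClosed A) (hB : IsClosed B)
    (hAB : Disjoint A B)
    (hv : ∀ v : cell C 0, map 0 v 0 ∈ A ∪ B → (v ∈ S → map 0 v 0 ∈ A) ∧ (v ∉ S → map 0 v 0 ∈ B))
    {n : ℕ} {e : cell C n} (he : Disjoint (A ∪ B) (openCell n e)) (hf : cellFrontier n e ⊆ A)
    (hS : ∀ v : cell C 0, map 0 v 0 ∈ openCell n e → v ∈ S) :
    SeparatedBy S (A ∪ B ∪ openCell n e) := by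
  have hcl : A ∪ closedCell n e = A ∪ openCell n e := by
    rw [← RelCWComplex.cellFrontier_union_openCell_eq_closedCell, ← Set.union_assoc,
      Set.union_eq_left.mpr hf]
  refine ⟨A ∪ openCell n e, B, ?_, hB, ?_, Set.union_right_comm _ _ _, ?_⟩
  · rw [← hcl]
    exact hA.union RelCWComplex.isClosed_closedCell
  · exact Set.disjoint_union_left.mpr ⟨hAB, (Set.disjoint_union_left.mp he).2.symm⟩
  · rintro v (h | h)
    · exact ⟨fun hs => Or.inl ((hv v h).1 hs), (hv v h).2⟩
    · exact ⟨fun _ => Or.inr h, fun hn => absurd (hS v h) hn⟩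

/-- A separation extends over every cell, when the two endpoints of each `1`-cell are on the same
side. -/
theorem SeparatedBy.union_openCell {S : Set (cell C 0)}
    (hS : ∀ e : cell C 1, head e ∈ S ↔ tail e ∈ S) {Z : Set X} (hZ : SeparatedBy S Z)
    {n : ℕ} {e : cell C n} (he : Disjoint Z (openCell n e)) (hf : cellFrontier n e ⊆ Z) :
    SeparatedBy S (Z ∪ openCell n e) := by
  have main : ∀ S : Set (cell C 0), SeparatedBy S Z →
      (∀ A B, IsClosed A → IsClosed B → Disjoint A B → A ∪ B = Z →
        (∀ v : cell C 0, map 0 v 0 ∈ Z → (v ∈ S → map 0 v 0 ∈ A) ∧ (v ∉ S → map 0 v 0 ∈ B)) →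
        cellFrontier n e ⊆ A ∧ (∀ v : cell C 0, map 0 v 0 ∈ openCell n e → v ∈ S) ∨
        cellFrontier n e ⊆ B ∧ (∀ v : cell C 0, map 0 v 0 ∈ openCell n e → v ∉ S)) →
      SeparatedBy S (Z ∪ openCell n e) := by
    rintro S ⟨A, B, hA, hB, hAB, rfl, hv⟩ hside
    obtain ⟨h1, h2⟩ | ⟨h1, h2⟩ := hside A B hA hB hAB rfl hv
    · exact SeparatedBy.attach hA hB hAB hv he h1 h2
    -- The roles of `A` and `B` are exchanged by passing to the complement of `S`.
    · rw [← compl_compl S, Set.union_comm A B]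
      rw [Set.union_comm A B] at he hv
      refine (SeparatedBy.attach hB hA hAB.symm ?_ he h1 h2).compl
      exact fun v h => ⟨(hv v h).2, fun hn => (hv v h).1 (not_not.mp hn)⟩
  refine main S hZ fun A B hA hB hAB hAZ hv => ?_
  obtain rfl | rfl | hn : n = 0 ∨ n = 1 ∨ 2 ≤ n := by omega
  · have h0 : ∀ v : cell C 0, map 0 v 0 ∈ openCell 0 e → v = e := fun v h => by
      simpa using zero_cell_eq_of_mem_openCell h
    rw [RelCWComplex.cellFrontier_zero_eq_empty]
    by_cases h : e ∈ S
    · exact Or.inl ⟨Set.empty_subset _, fun v hv => h0 v hv ▸ h⟩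
    · exact Or.inr ⟨Set.empty_subset _, fun v hv => h0 v hv ▸ h⟩
  · have h1 : ∀ v : cell C 0, map 0 v 0 ∉ openCell 1 e := fun v h =>
      zero_ne_one (congrArg Sigma.fst (zero_cell_eq_of_mem_openCell h))
    rw [cellFrontier_one_eq_tail_head, Set.insert_subset_iff, Set.singleton_subset_iff] at hf ⊢
    rw [Set.insert_subset_iff, Set.singleton_subset_iff]
    by_cases h : tail e ∈ S
    · exact Or.inl ⟨⟨(hv _ hf.1).1 h, (hv _ hf.2).1 ((hS e).mpr h)⟩, fun v hv => absurd hv (h1 v)⟩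
    · exact Or.inr ⟨⟨(hv _ hf.1).2 h, (hv _ hf.2).2 fun h' => h ((hS e).mp h')⟩,
        fun v hv => absurd hv (h1 v)⟩
  · have h1 : ∀ v : cell C 0, map 0 v 0 ∉ openCell n e := fun v h =>
      absurd (congrArg Sigma.fst (zero_cell_eq_of_mem_openCell h)) (by simp; omega)
    rw [← hAZ] at hf
    -- A connected frontier lies in one of the two disjoint closed parts.
    obtain h | h := isPreconnected_iff_subset_of_disjoint_closed.mp
      (isPreconnected_cellFrontier hn e) A B hA hB hf (by rw [hAB.inter_eq, Set.inter_empty])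
    · exact Or.inl ⟨h, fun v hv => absurd hv (h1 v)⟩
    · exact Or.inr ⟨h, fun v hv => absurd hv (h1 v)⟩

namespace CellFiltration

variable {K : ℕ} (F : CellFiltration C K)

theorem mem_sub_cellAt (k : Fin (K + 1)) (x : CellIndex K) :
    (F.cellAt x).2 ∈ (F.sub k).I (F.cellAt x).1 ↔ (k : WithTop (Fin (K + 1))) < x.1 := by
  rw [F.mem_sub, Sigma.eta, Equiv.symm_apply_apply]

theorem castSucc_lt_iff (i : Fin K) (x : CellIndex K) :
    ((i.castSucc : Fin (K + 1)) : WithTop (Fin (K + 1))) < x.1 ↔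
      ((i.succ : Fin (K + 1)) : WithTop (Fin (K + 1))) < x.1 ∨ x = CellIndex.succ i := by
  obtain ⟨x, hx⟩ := x
  simp only [CellIndex.succ, Subtype.mk.injEq]
  induction x using WithTop.recTopCoe with
  | top => simp
  | coe x =>
    simp only [WithTop.coe_lt_coe, WithTop.coe_inj, Fin.castSucc_lt_iff_succ_le]
    rw [le_iff_lt_or_eq, eq_comm (a := x)]

theorem last_lt_iff (x : CellIndex K) :
    ((Fin.last K : Fin (K + 1)) : WithTop (Fin (K + 1))) < x.1 ↔ x = CellIndex.infty K := by
  obtain ⟨x, hx⟩ := x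
  simp only [CellIndex.infty, Subtype.mk.injEq]
  induction x using WithTop.recTopCoe with
  | top => simp
  | coe x => simp [Fin.le_last x]

theorem zero_lt (x : CellIndex K) : ((0 : Fin (K + 1)) : WithTop (Fin (K + 1))) < x.1 := by
  obtain ⟨x, hx⟩ := x
  induction x using WithTop.recTopCoe with
  | top => simp
  | coe x =>
    rw [WithTop.coe_lt_coe]
    exact Fin.pos_of_ne_zero fun h => hx (by simp [h])

theorem coe_sub_zero : (F.sub 0 : Set X) = C := by
  rw [← CWComplex.Subcomplex.union]
  refine Eq.trans ?_ (CWComplex.iUnion_openCell_eq_complex (C := C))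
  refine Set.iUnion_congr fun n => ?_
  apply Set.Subset.antisymm
  · exact Set.iUnion_subset fun c => Set.subset_iUnion_of_subset c.1 subset_rfl
  · exact Set.iUnion_subset fun c =>
      Set.subset_iUnion_of_subset ⟨c, (F.mem_sub _ _ _).mpr (zero_lt _)⟩ subset_rfl

/-- The separation is built by attaching one cell at a time, in the order `σ_∞, σ_K, …`. At `k = 0`
it separates `Y` itself, which contradicts connectedness if `S` is neither empty nor everything. -/
theorem separatedBy_sub {S : Set (cell C 0)} (hS : ∀ e : cell C 1, head e ∈ S ↔ tail e ∈ S)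
    (k : Fin (K + 1)) : SeparatedBy S (F.sub k : Set X) := by
  induction k using Fin.reverseInduction with
  | last =>
    -- `Y_K` is treated as a cell attached to the empty set, so the attaching lemma also covers the
    -- base case.
    have hE : (F.sub (Fin.last K) : Set X) =
        ∅ ∪ openCell _ (F.cellAt (CellIndex.infty K)).2 := by
      rw [← CWComplex.Subcomplex.union, Set.empty_union]
      have hmem : ∀ m (c : cell C m), c ∈ (F.sub (Fin.last K)).I m ↔
          (⟨m, c⟩ : (n : ℕ) × cell C n) = F.cellAt (CellIndex.infty K) := fun m c => by
        rw [F.mem_sub, last_lt_iff, Equiv.symm_apply_eq]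
      apply Set.Subset.antisymm
      · simp only [Set.iUnion_subset_iff]
        rintro m ⟨c, hc⟩
        rw [← (hmem m c).mp hc]
      · exact Set.subset_iUnion₂_of_subset _ ⟨_, (hmem _ _).mpr rfl⟩ subset_rfl
    rw [hE]
    refine SeparatedBy.union_openCell hS ?_ (Set.empty_disjoint _) ?_
    · exact ⟨∅, ∅, isClosed_empty, isClosed_empty, Set.empty_disjoint _, Set.union_empty _,
        fun v h => h.elim⟩
    · have h0 := F.dim_infty
      generalize F.cellAt (CellIndex.infty K) = c at h0 ⊢
      obtain ⟨n, c⟩ := c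
      obtain rfl : n = 0 := h0
      rw [RelCWComplex.cellFrontier_zero_eq_empty]
  | cast i ih =>
    have hE : (F.sub i.castSucc : Set X) =
        (F.sub i.succ : Set X) ∪ openCell _ (F.cellAt (CellIndex.succ i)).2 := by
      refine Subcomplex.eq_union_openCell fun m c => ?_
      rw [F.mem_sub, F.mem_sub, castSucc_lt_iff, Sigma.eta, Equiv.symm_apply_eq]
    have hd : Disjoint (F.sub i.succ : Set X) (openCell _ (F.cellAt (CellIndex.succ i)).2) := by
      refine (RelCWComplex.Subcomplex.disjoint_openCell_subcomplex_of_not_mem _ ?_).symm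
      rw [mem_sub_cellAt]
      exact lt_irrefl _
    rw [hE]
    refine ih.union_openCell hS hd ?_
    -- The frontier of the new cell lies in the larger subcomplex and misses the open cell, hence
    -- lies in the smaller one.
    intro x hx
    have h1 : x ∈ (F.sub i.castSucc : Set X) :=
      RelCWComplex.Subcomplex.cellFrontier_subset_of_mem _
        ((F.mem_sub_cellAt _ _).mpr ((castSucc_lt_iff _ _).mpr (Or.inr rfl))) hx
    rw [hE] at h1
    exact h1.resolve_right (Set.disjoint_left.mp (disjoint_cellFrontier_openCell _ _) hx)

/-- In a connected complex, a set of `0`-cells that contains both or none of the endpoints of every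
`1`-cell is empty or contains all `0`-cells. -/
theorem mem_iff_mem (F : CellFiltration C K) {S : Set (cell C 0)} (hS : ∀ e : cell C 1, head e ∈ S ↔ tail e ∈ S)
    (v w : cell C 0) : v ∈ S ↔ w ∈ S := by
  have key : ∀ v w : cell C 0, v ∈ S → w ∈ S := by
    intro v w hvS
    by_contra hwS
    obtain ⟨A, B, hA, hB, hAB, hC, hv⟩ := F.separatedBy_sub hS 0
    rw [F.coe_sub_zero] at hC hv
    have hm : ∀ v : cell C 0, map 0 v 0 ∈ C := fun v =>
      RelCWComplex.openCell_subset_complex 0 v (RelCWComplex.map_zero_mem_openCell 0 v)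
    have hvA := (hv v (hm v)).1 hvS
    have hwB := (hv w (hm w)).2 hwS
    obtain h | h := isPreconnected_iff_subset_of_disjoint_closed.mp F.connected.isPreconnected
      A B hA hB hC.ge (by rw [hAB.inter_eq, Set.inter_empty])
    · exact Set.disjoint_left.mp hAB (h (hm w)) hwB
    · exact Set.disjoint_left.mp hAB hvA (h (hm v))
  exact ⟨key v w, key w v⟩

end CellFiltration

end Connectedness


/-! ### Directed forests and their roots. -/

namespace Graph

variable {K : ℕ}

/-- Every node has at most one outgoing edge, and edges go up. -/
structure IsForest (G : Graph K) : Prop where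
  lt : ∀ e ∈ G.edges, e.source < e.target
  source_injOn : Set.InjOn Edge.source (G.edges : Set (Edge K))

/-- Each iteration of `follow` either stays put or traverses an edge, so no forest hypothesis is
needed. -/
theorem root_induction {G : Graph K} {p : CellIndex K → Prop}
    (hp : ∀ e ∈ G.edges, p e.source → p e.target) {x : CellIndex K} (hx : p x) : p (root G x) := by
  have hf : ∀ y, p y → p (follow G y) := by
    intro y hy
    unfold follow
    split_ifs with h
    · exact hp _ h.choose_spec.1 (by rwa [h.choose_spec.2])
    · exact hy
  unfold root
  generalize G.edges.card = n
  induction n with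
  | zero => exact hx
  | succ n ih => rw [Function.iterate_succ_apply']; exact hf _ ih

variable {G : Graph K}

theorem apply_root {A : Type*} {f : CellIndex K → A}
    (hf : ∀ e ∈ G.edges, f e.source = f e.target) (x : CellIndex K) : f (root G x) = f x :=
  root_induction (p := fun y => f y = f x) (fun e he h => (hf e he).symm.trans h) rfl

theorem follow_of_forall_ne {x : CellIndex K} (h : ∀ e ∈ G.edges, e.source ≠ x) :
    follow G x = x :=
  dif_neg fun ⟨e, he, hx⟩ => h e he hx

namespace IsForest

variable (hG : G.IsForest)
include hG

theorem le_root (x : CellIndex K) : x ≤ root G x :=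
  root_induction (p := fun y => x ≤ y) (fun e he h => h.trans (hG.lt e he).le) le_rfl

theorem follow_source {e : Edge K} (he : e ∈ G.edges) : follow G e.source = e.target := by
  have h : ∃ e' ∈ G.edges, e'.source = e.source := ⟨e, he, rfl⟩
  rw [follow, dif_pos h]
  exact congrArg _ (hG.source_injOn h.choose_spec.1 he h.choose_spec.2)

-- Following an edge from `x` strictly shrinks the set of edges with source at least the current
-- node, since the edge just used drops out. The size of this set therefore bounds the number of
-- steps to a fixed point; in particular `G.edges.card` iterations suffice in `root`.
open Classical in
theorem follow_iterate (n : ℕ) (x : CellIndex K)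
    (hn : (G.edges.filter fun e => x ≤ e.source).card ≤ n) :
    follow G ((follow G)^[n] x) = (follow G)^[n] x := by
  by_cases hx : ∃ e ∈ G.edges, e.source = x
  · obtain ⟨e, he, rfl⟩ := hx
    induction n generalizing e with
    | zero =>
      have := Finset.card_eq_zero.mp (Nat.le_zero.mp hn)
      exact (Finset.filter_eq_empty_iff.mp this he le_rfl).elim
    | succ n ih =>
      rw [Function.iterate_succ_apply, hG.follow_source he]
      by_cases ht : ∃ e' ∈ G.edges, e'.source = e.target
      · obtain ⟨e', he', h'⟩ := ht
        rw [← h']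
        refine ih e' he' (Nat.lt_succ_iff.mp (lt_of_lt_of_le (Finset.card_lt_card ?_) hn))
        refine (Finset.ssubset_iff_of_subset fun a ha => ?_).mpr ⟨e, ?_, ?_⟩
        · rw [Finset.mem_filter] at ha ⊢
          exact ⟨ha.1, (hG.lt e he).le.trans (h' ▸ ha.2)⟩
        · exact Finset.mem_filter.mpr ⟨he, le_rfl⟩
        · intro h
          exact absurd (hG.lt e he) (not_lt.mpr (h' ▸ (Finset.mem_filter.mp h).2))
      · have hf := follow_of_forall_ne (G := G) (x := e.target) fun e' he' h => ht ⟨e', he', h⟩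
        rw [Function.iterate_fixed hf, hf]
  · have hf := follow_of_forall_ne (G := G) (x := x) fun e' he' h => hx ⟨e', he', h⟩
    rw [Function.iterate_fixed hf, hf]

theorem follow_root (x : CellIndex K) : follow G (root G x) = root G x := by
  classical
  exact hG.follow_iterate _ x (Finset.card_filter_le _ _)

theorem source_ne_root {e : Edge K} (he : e ∈ G.edges) (x : CellIndex K) :
    e.source ≠ root G x := by
  intro h
  have h1 := hG.follow_root x
  rw [← h, hG.follow_source he] at h1
  exact (hG.lt e he).ne' h1

theorem root_source {e : Edge K} (he : e ∈ G.edges) : root G e.source = root G e.target := by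
  have h := hG.follow_root e.source
  rw [root, ← Function.iterate_succ_apply' (follow G), Function.iterate_succ_apply,
    hG.follow_source he] at h
  exact h.symm

theorem root_infty : root G (CellIndex.infty K) = CellIndex.infty K :=
  le_antisymm (Subtype.coe_le_coe.mp le_top) (hG.le_root _)

/-- Differences along the edges of a forest can be prescribed. -/
theorem exists_sub_eq {A : Type*} [AddCommGroup A] (c : Edge K → A) :
    ∃ g : CellIndex K → A, ∀ e ∈ G.edges, g e.source - g e.target = c e := by
  classical
  have hwf : WellFounded fun x y : CellIndex K => y < x :=
    Finite.wellFounded_of_trans_of_irrefl _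
  -- Recursion from large indices to small: roots get `0`, and any other node gets the value at its
  -- unique target plus the prescribed difference.
  let step : ∀ x : CellIndex K, (∀ y, x < y → A) → A := fun x g =>
    if h : ∃ e ∈ G.edges, e.source = x then
      g h.choose.target (by
        have h1 := hG.lt _ h.choose_spec.1
        rwa [h.choose_spec.2] at h1) + c h.choose
    else 0
  refine ⟨hwf.fix step, fun e he => ?_⟩
  have h : ∃ e' ∈ G.edges, e'.source = e.source := ⟨e, he, rfl⟩
  have h2 : h.choose = e := hG.source_injOn h.choose_spec.1 he h.choose_spec.2
  rw [hwf.fix_eq step e.source]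
  simp only [step]
  rw [dif_pos h, h2, add_sub_cancel_left]

end IsForest

end Graph

/-! ### The invariant of the merge-tree algorithm. -/

namespace CellFiltration

open Topology Topology.CWComplex

variable {X : Type u} [TopologicalSpace X] [T2Space X] {C : Set X} [CWComplex C] {K : ℕ}
  (F : CellFiltration C K)

/-- The index of a `0`-cell. -/
def vertexIndex (v : cell C 0) : CellIndex K := F.cellAt.symm ⟨0, v⟩

theorem vertexIndex_injective : Function.Injective F.vertexIndex := fun v w h => by
  simpa [vertexIndex] using h

theorem lt_vertexIndex_tail {k : Fin (K + 1)} {c : cell C 1}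
    (h : (k : WithTop (Fin (K + 1))) < (F.cellAt.symm ⟨1, c⟩).1) :
    (k : WithTop (Fin (K + 1))) < (F.vertexIndex (tail c)).1 :=
  (F.mem_sub _ _ _).mp (tail_mem _ ((F.mem_sub _ _ _).mpr h))

theorem lt_vertexIndex_head {k : Fin (K + 1)} {c : cell C 1}
    (h : (k : WithTop (Fin (K + 1))) < (F.cellAt.symm ⟨1, c⟩).1) :
    (k : WithTop (Fin (K + 1))) < (F.vertexIndex (head c)).1 :=
  (F.mem_sub _ _ _).mp (head_mem _ ((F.mem_sub _ _ _).mpr h))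

theorem castSucc_lt_index {i : Fin K} {n : ℕ} {c : cell C n}
    (h : F.cellAt (CellIndex.succ i) = ⟨n, c⟩) :
    ((i.castSucc : Fin (K + 1)) : WithTop (Fin (K + 1))) < (F.cellAt.symm ⟨n, c⟩).1 := by
  rw [castSucc_lt_iff, ← h, Equiv.symm_apply_apply]
  exact Or.inr rfl

theorem succ_lt_vertexIndex {i : Fin K} {c : cell C 1}
    (h : F.cellAt (CellIndex.succ i) = ⟨1, c⟩) {v : cell C 0}
    (hv : ((i.castSucc : Fin (K + 1)) : WithTop (Fin (K + 1))) < (F.vertexIndex v).1) :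
    ((i.succ : Fin (K + 1)) : WithTop (Fin (K + 1))) < (F.vertexIndex v).1 := by
  refine ((castSucc_lt_iff _ _).mp hv).resolve_right fun hi => ?_
  rw [← hi, vertexIndex, Equiv.apply_symm_apply] at h
  exact zero_ne_one (congrArg Sigma.fst h)

/-- `G` is a forest on the `0`-cells of `Y_k`, with labels above `k`, whose trees are the components
of the `1`-skeleton of `Y_k`: the functions that are constant along its edges are those that are
constant on the endpoints of each `1`-cell. -/
structure IsMergeForest (k : Fin (K + 1)) (G : Graph K) : Prop extends G.IsForest where
  lt_label : ∀ e ∈ G.edges, k < e.label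
  label_lt_source : ∀ e ∈ G.edges, (e.label : WithTop (Fin (K + 1))) < e.source.1
  source_mem : ∀ e ∈ G.edges, e.source ∈ Set.range F.vertexIndex
  target_mem : ∀ e ∈ G.edges, e.target ∈ Set.range F.vertexIndex
  const_iff : ∀ f : CellIndex K → ZMod 2, (∀ e ∈ G.edges, f e.source = f e.target) ↔
    ∀ c : cell C 1, (k : WithTop (Fin (K + 1))) < (F.cellAt.symm ⟨1, c⟩).1 →
      f (F.vertexIndex (tail c)) = f (F.vertexIndex (head c))

variable {F}

theorem forall_one_cell_iff {i : Fin K} {p : cell C 1 → Prop} :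
    (∀ c : cell C 1, ((i.castSucc : Fin (K + 1)) : WithTop (Fin (K + 1))) <
        (F.cellAt.symm ⟨1, c⟩).1 → p c) ↔
      (∀ c : cell C 1, ((i.succ : Fin (K + 1)) : WithTop (Fin (K + 1))) <
        (F.cellAt.symm ⟨1, c⟩).1 → p c) ∧
      ∀ c : cell C 1, F.cellAt (CellIndex.succ i) = ⟨1, c⟩ → p c := by
  simp only [castSucc_lt_iff, or_imp, forall_and, Equiv.symm_apply_eq,
    eq_comm (b := F.cellAt (CellIndex.succ i))]

/-- A `1`-cell inside one tree adds no condition: a function constant along edges has the value of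
the common root at both endpoints. -/
theorem IsMergeForest.of_edges_eq {i : Fin K} {G G' : Graph K} (hG : F.IsMergeForest i.succ G)
    (hE : G'.edges = G.edges)
    (h : ∀ c : cell C 1, F.cellAt (CellIndex.succ i) = ⟨1, c⟩ →
      root G (F.vertexIndex (tail c)) = root G (F.vertexIndex (head c))) :
    F.IsMergeForest i.castSucc G' where
  lt := hE ▸ hG.lt
  source_injOn := hE ▸ hG.source_injOn
  lt_label := hE ▸ fun e he => i.castSucc_lt_succ.trans (hG.lt_label e he)
  label_lt_source := hE ▸ hG.label_lt_source
  source_mem := hE ▸ hG.source_mem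
  target_mem := hE ▸ hG.target_mem
  const_iff f := by
    rw [forall_one_cell_iff, ← hG.const_iff, hE]
    refine (and_iff_left_of_imp fun hf c hc => ?_).symm
    rw [← Graph.apply_root hf, h c hc, Graph.apply_root hf]

-- For functions constant along the old edges, equality at the endpoints of the new `1`-cell is
-- equality at their roots, which is the condition along the new edge. A root has no outgoing edge,
-- so sources stay distinct.
open Classical in
theorem IsMergeForest.insert {i : Fin K} {G : Graph K} (hG : F.IsMergeForest i.succ G)
    {c : cell C 1} (hc : F.cellAt (CellIndex.succ i) = ⟨1, c⟩) {v w : cell C 0}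
    (hvw : v = tail c ∧ w = head c ∨ v = head c ∧ w = tail c) {N : Finset (CellIndex K)}
    (hlt : root G (F.vertexIndex v) < root G (F.vertexIndex w)) :
    F.IsMergeForest i.castSucc
      ⟨N, insert ⟨root G (F.vertexIndex v), i.succ, root G (F.vertexIndex w)⟩ G.edges⟩ := by
  have hroot : ∀ v, root G (F.vertexIndex v) ∈ Set.range F.vertexIndex := fun v =>
    Graph.root_induction (fun e he _ => hG.target_mem e he) ⟨v, rfl⟩
  refine ⟨⟨?_, ?_⟩, ?_, ?_, ?_, ?_, ?_⟩
  · exact Finset.forall_mem_insert _ _ _ |>.mpr ⟨hlt, hG.lt⟩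
  · rw [Finset.coe_insert]
    refine (Set.injOn_insert fun h => hG.source_ne_root h _ rfl).mpr ⟨hG.source_injOn, ?_⟩
    rintro ⟨e, he, h⟩
    exact hG.source_ne_root he _ h
  · exact Finset.forall_mem_insert _ _ _ |>.mpr ⟨i.castSucc_lt_succ,
      fun e he => i.castSucc_lt_succ.trans (hG.lt_label e he)⟩
  · refine Finset.forall_mem_insert _ _ _ |>.mpr ⟨?_, hG.label_lt_source⟩
    -- The endpoints lie in the subcomplex preceding the `1`-cell, and passing to a root only
    -- increases the index.
    refine lt_of_lt_of_le (F.succ_lt_vertexIndex hc ?_) (hG.le_root _)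
    obtain ⟨rfl, -⟩ | ⟨rfl, -⟩ := hvw
    · exact F.lt_vertexIndex_tail (F.castSucc_lt_index hc)
    · exact F.lt_vertexIndex_head (F.castSucc_lt_index hc)
  · exact Finset.forall_mem_insert _ _ _ |>.mpr ⟨hroot v, hG.source_mem⟩
  · exact Finset.forall_mem_insert _ _ _ |>.mpr ⟨hroot w, hG.target_mem⟩
  · intro f
    rw [forall_one_cell_iff, ← hG.const_iff, Finset.forall_mem_insert, and_comm]
    refine and_congr_right fun hf => ?_
    have hc' : ∀ c' : cell C 1, F.cellAt (CellIndex.succ i) = ⟨1, c'⟩ ↔ c = c' := fun c' => by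
      simp [hc]
    simp only [hc', forall_eq', Graph.apply_root hf]
    obtain ⟨rfl, rfl⟩ | ⟨rfl, rfl⟩ := hvw
    · rfl
    · exact eq_comm

variable (F)

/-- One step of the algorithm keeps the invariant and only adds edges labelled `i + 1`. -/
theorem step_isMergeForest (i : Fin K) {G : Graph K} (hG : F.IsMergeForest i.succ G) :
    F.IsMergeForest i.castSucc (F.step i G) ∧
      ∀ e, e ∈ G.edges ↔ e ∈ (F.step i G).edges ∧ i.succ < e.label := by
  classical
  have hself : ∀ e, e ∈ G.edges ↔ e ∈ G.edges ∧ i.succ < e.label := fun e =>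
    (and_iff_left_of_imp (hG.lt_label e)).symm
  have hins : ∀ a b e, e ∈ G.edges ↔
      e ∈ Insert.insert (⟨a, i.succ, b⟩ : Edge K) G.edges ∧ i.succ < e.label := by
    intro a b e
    rw [Finset.mem_insert, or_and_right, ← hself, or_iff_right]
    rintro ⟨rfl, h⟩
    exact lt_irrefl _ h
  obtain ⟨⟨n, c⟩, hc⟩ : ∃ c, F.cellAt (CellIndex.succ i) = c := ⟨_, rfl⟩
  match n, c, hc with
  | 0, v, hc =>
    have hs : F.step i G = ⟨Insert.insert (CellIndex.succ i) G.nodes, G.edges⟩ := by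
      unfold step
      rw [hc]
    rw [hs]
    refine ⟨hG.of_edges_eq rfl fun c h => ?_, hself⟩
    exact absurd (congrArg Sigma.fst (hc.symm.trans h)) zero_ne_one
  | 1, c, hc =>
    have hs : F.step i G =
        if root G (F.vertexIndex (tail c)) = root G (F.vertexIndex (head c)) then G
        else if root G (F.vertexIndex (tail c)) > root G (F.vertexIndex (head c)) then
          ⟨G.nodes, Insert.insert ⟨root G (F.vertexIndex (head c)), i.succ,
            root G (F.vertexIndex (tail c))⟩ G.edges⟩
        else ⟨G.nodes, Insert.insert ⟨root G (F.vertexIndex (tail c)), i.succ,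
          root G (F.vertexIndex (head c))⟩ G.edges⟩ := by
      unfold step
      rw [hc]
      rfl
    rw [hs]
    split_ifs with h1 h2
    · refine ⟨hG.of_edges_eq rfl fun c' h => ?_, hself⟩
      obtain rfl : c = c' := by simpa using hc.symm.trans h
      exact h1
    · exact ⟨hG.insert hc (Or.inr ⟨rfl, rfl⟩) h2, hins _ _⟩
    · exact ⟨hG.insert hc (Or.inl ⟨rfl, rfl⟩) (lt_of_le_of_ne (not_lt.mp h2) h1), hins _ _⟩
  | m + 2, c, hc =>
    have hs : F.step i G = G := by
      unfold step
      rw [hc]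
    rw [hs]
    refine ⟨hG.of_edges_eq rfl fun c h => ?_, hself⟩
    have := congrArg Sigma.fst (hc.symm.trans h)
    simp at this

theorem mergeTree_last :
    F.mergeTree (Fin.last K) = ⟨{CellIndex.infty K}, ∅⟩ := by
  simp [mergeTree]

theorem mergeTree_castSucc (i : Fin K) :
    F.mergeTree i.castSucc = F.step i (F.mergeTree i.succ) := by
  simp [mergeTree]

theorem mergeTree_isMergeForest (k : Fin (K + 1)) : F.IsMergeForest k (F.mergeTree k) := by
  induction k using Fin.reverseInduction with
  | last =>
    rw [mergeTree_last]
    refine ⟨⟨by simp, by simp⟩, by simp, by simp, by simp, by simp, fun f => ?_⟩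
    refine ⟨fun _ c hc => ?_, fun _ => by simp⟩
    have h := F.dim_infty
    rw [last_lt_iff, Equiv.symm_apply_eq] at hc
    rw [← hc] at h
    exact absurd h one_ne_zero
  | cast i ih =>
    rw [mergeTree_castSucc]
    exact (F.step_isMergeForest i ih).1

/-- This allows every stage `Y_k` to be described by the single final tree. -/
theorem mem_mergeTree_edges_iff (k : Fin (K + 1)) (e : Edge K) :
    e ∈ (F.mergeTree k).edges ↔ e ∈ (F.mergeTree 0).edges ∧ k < e.label := by
  induction k using Fin.induction with
  | zero => exact (and_iff_left_of_imp ((F.mergeTree_isMergeForest 0).lt_label e)).symm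
  | succ i ih =>
    rw [(F.step_isMergeForest i (F.mergeTree_isMergeForest i.succ)).2, ← mergeTree_castSucc, ih,
      and_assoc, and_iff_right_of_imp fun h => i.castSucc_lt_succ.trans h]

theorem exists_vertexIndex_eq_infty : ∃ v, F.vertexIndex v = CellIndex.infty K := by
  have h := F.dim_infty
  obtain ⟨⟨n, c⟩, hc⟩ : ∃ c, F.cellAt (CellIndex.infty K) = c := ⟨_, rfl⟩
  rw [hc] at h
  obtain rfl : n = 0 := h
  exact ⟨c, by rw [vertexIndex, ← hc, Equiv.symm_apply_apply]⟩

/-- As `Y` is connected, `σ_∞` is the only root of the merge tree. -/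
theorem exists_edge {x : CellIndex K} (hx : x ∈ Set.range F.vertexIndex)
    (hne : x ≠ CellIndex.infty K) : ∃ e ∈ (F.mergeTree 0).edges, e.source = x := by
  classical
  by_contra! hnone
  have hG := F.mergeTree_isMergeForest 0
  obtain ⟨v, rfl⟩ := hx
  obtain ⟨v', hv'⟩ := F.exists_vertexIndex_eq_infty
  have hself : root (F.mergeTree 0) (F.vertexIndex v) = F.vertexIndex v :=
    Function.iterate_fixed (Graph.follow_of_forall_ne hnone) _
  -- The indicator of the tree rooted at `v` would split the vertices of `Y`, with `σ_∞` on the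
  -- other side.
  let f : CellIndex K → ZMod 2 := fun y =>
    if root (F.mergeTree 0) y = F.vertexIndex v then 1 else 0
  have hf := (hG.const_iff f).mp fun e he => by simp only [f, hG.root_source he]
  have h := F.mem_iff_mem (S := {w | f (F.vertexIndex w) = 1})
    (fun e => by rw [Set.mem_ofPred_eq, Set.mem_ofPred_eq, hf e (zero_lt _)]) v v'
  have h1 : f (F.vertexIndex v) = 1 := if_pos hself
  have h2 : f (F.vertexIndex v') = 0 := if_neg (by rw [hv', hG.root_infty]; exact hne.symm)
  exact zero_ne_one (h2.symm.trans (h.mp h1))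

end CellFiltration


/-! ### Edge differences as coordinates on reduced cohomology. -/

namespace CellFiltration

open Topology Topology.CWComplex

variable {X : Type u} [TopologicalSpace X] [T2Space X] {C : Set X} [CWComplex C] {K : ℕ}
  (F : CellFiltration C K)

open Classical in
/-- A `0`-cochain of `Y_k` as a function of the indices of its cells, extended by zero. -/
noncomputable def extendByZero (k : Fin (K + 1)) :
    Cochain (F.sub k) 0 →ₗ[ZMod 2] (CellIndex K → ZMod 2) where
  toFun f x := if h : ∃ v : (F.sub k).I 0, F.vertexIndex v.1 = x then f h.choose else 0
  map_add' f g := by ext x; simp only [Pi.add_apply]; split_ifs <;> simp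
  map_smul' c f := by
    ext x; simp only [Pi.smul_apply, RingHom.id_apply]; split_ifs <;> simp

theorem extendByZero_vertexIndex {k : Fin (K + 1)} (f : Cochain (F.sub k) 0) (v : (F.sub k).I 0) :
    F.extendByZero k f (F.vertexIndex v.1) = f v := by
  have h : ∃ w : (F.sub k).I 0, F.vertexIndex w.1 = F.vertexIndex v.1 := ⟨v, rfl⟩
  refine (dif_pos h).trans (congrArg f (Subtype.ext (F.vertexIndex_injective h.choose_spec)))

/-- `extendByZero` at the index of a `0`-cell of `Y_k`. -/
theorem exists_extendByZero_eq {k : Fin (K + 1)} {x : CellIndex K}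
    (hx : x ∈ Set.range F.vertexIndex) (hk : (k : WithTop (Fin (K + 1))) < x.1) :
    ∃ v : (F.sub k).I 0, F.vertexIndex v.1 = x ∧ ∀ f, F.extendByZero k f x = f v := by
  obtain ⟨v, rfl⟩ := hx
  exact ⟨⟨v, (F.mem_sub _ _ _).mpr hk⟩, rfl, fun f => F.extendByZero_vertexIndex f ⟨v, _⟩⟩

theorem extendByZero_restrict {j k : Fin (K + 1)} (h : j ≤ k) (f : Cochain (F.sub j) 0)
    {x : CellIndex K} (hx : x ∈ Set.range F.vertexIndex) (hk : (k : WithTop (Fin (K + 1))) < x.1) :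
    F.extendByZero k (restrictCochain (F.sub_anti h) f) x = F.extendByZero j f x := by
  obtain ⟨v, rfl, hv⟩ := F.exists_extendByZero_eq hx hk
  rw [hv]
  exact (F.extendByZero_vertexIndex f ⟨v.1, F.sub_anti h 0 v.2⟩).symm

/-- A cocycle of `Y_k` is constant along the edges of the merge tree with labels above `k`. -/
theorem extendByZero_source_eq {k : Fin (K + 1)} {f : Cochain (F.sub k) 0}
    (hf : f ∈ Cocycle (F.sub k)) {e : Edge K} (he : e ∈ (F.mergeTree 0).edges) (hk : k < e.label) :
    F.extendByZero k f e.source = F.extendByZero k f e.target := by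
  refine ((F.mergeTree_isMergeForest k).const_iff _).mpr (fun c hc => ?_) e
    ((F.mem_mergeTree_edges_iff k e).mpr ⟨he, hk⟩)
  have hc' : c ∈ (F.sub k).I 1 := (F.mem_sub _ _ _).mpr hc
  have h1 := F.extendByZero_vertexIndex f ⟨tail c, tail_mem _ hc'⟩
  have h2 := F.extendByZero_vertexIndex f ⟨head c, head_mem _ hc'⟩
  rw [h1, h2]
  exact (sub_eq_zero.mp (congrFun (LinearMap.mem_ker.mp hf) ⟨c, hc'⟩)).symm

theorem mem_cocycle_of_mergeTree {k : Fin (K + 1)} {g : CellIndex K → ZMod 2}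
    (hg : ∀ e ∈ (F.mergeTree 0).edges, k < e.label → g e.source = g e.target) :
    (fun v => g (F.vertexIndex v.1) : Cochain (F.sub k) 0) ∈ Cocycle (F.sub k) := by
  rw [LinearMap.mem_ker]
  ext c
  refine sub_eq_zero.mpr (((F.mergeTree_isMergeForest k).const_iff g).mp (fun e he => ?_) c.1
    ((F.mem_sub _ _ _).mp c.2)).symm
  obtain ⟨he, hk⟩ := (F.mem_mergeTree_edges_iff k e).mp he
  exact hg e he hk

section Coordinates

variable {p : ℕ} (ε : Fin p ≃ {e // e ∈ (F.mergeTree 0).edges})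

/-- The direct sum of the intervals given by the edges of the merge tree. -/
noncomputable abbrev edgeIntervals : PersistenceModule.{0, 0, 0} (ZMod 2) (Fin (K + 1)) :=
  PersistenceModule.directSum fun i =>
    PersistenceModule.interval (ZMod 2) (ε i).1.label (ε i).1.source.1

/-- The differences of a cocycle along the edges of the merge tree. -/
noncomputable def differences (k : Fin (K + 1)) :
    Cocycle (F.sub k) →ₗ[ZMod 2] (F.edgeIntervals ε).obj k where
  toFun f i _ := F.extendByZero k f.1 (ε i).1.source - F.extendByZero k f.1 (ε i).1.target
  map_add' f g := by
    funext i _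
    refine Eq.trans ?_ (add_sub_add_comm _ _ _ _)
    rw [Submodule.coe_add, map_add]
    rfl
  map_smul' c f := by
    funext i _
    refine Eq.trans ?_ (mul_sub c _ _).symm
    rw [Submodule.coe_smul, map_smul]
    rfl

theorem differences_apply {k : Fin (K + 1)} (f : Cocycle (F.sub k)) (i : Fin p)
    (h : PLift ((ε i).1.label ≤ k ∧ (k : WithTop (Fin (K + 1))) < (ε i).1.source.1)) :
    F.differences ε k f i h =
      F.extendByZero k f.1 (ε i).1.source - F.extendByZero k f.1 (ε i).1.target :=
  rfl

theorem lt_target {k : Fin (K + 1)} {e : Edge K} (he : e ∈ (F.mergeTree 0).edges)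
    (hk : (k : WithTop (Fin (K + 1))) < e.source.1) : (k : WithTop (Fin (K + 1))) < e.target.1 :=
  hk.trans ((F.mergeTree_isMergeForest 0).lt e he)

/-- A cocycle whose differences vanish is constant. -/
theorem extendByZero_eq_infty {k : Fin (K + 1)} {f : Cocycle (F.sub k)}
    (hf : F.differences ε k f = 0) (x : CellIndex K) (hx : x ∈ Set.range F.vertexIndex)
    (hk : (k : WithTop (Fin (K + 1))) < x.1) :
    F.extendByZero k f.1 x = F.extendByZero k f.1 (CellIndex.infty K) := by
  have hwf : WellFounded fun x y : CellIndex K => y < x :=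
    Finite.wellFounded_of_trans_of_irrefl _
  induction x using hwf.induction with
  | _ x ih =>
  by_cases hne : x = CellIndex.infty K
  · rw [hne]
  · obtain ⟨e, he, rfl⟩ := F.exists_edge hx hne
    have hG := F.mergeTree_isMergeForest 0
    rw [← ih e.target (hG.lt e he) (hG.target_mem e he) (F.lt_target he hk)]
    -- If the label is at most `k`, the difference is one of the vanishing coordinates; otherwise
    -- the cocycle condition forces it to vanish.
    by_cases hl : e.label ≤ k
    · obtain ⟨i, rfl⟩ : ∃ i, (ε i).1 = e := ⟨ε.symm ⟨e, he⟩, by rw [Equiv.apply_symm_apply]⟩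
      have h := F.differences_apply ε f i ⟨hl, hk⟩
      rw [hf] at h
      exact sub_eq_zero.mp h.symm
    · exact F.extendByZero_source_eq f.2 he (not_le.mp hl)

theorem ker_differences (k : Fin (K + 1)) :
    (LinearMap.range (augmentation (F.sub k))).submoduleOf (Cocycle (F.sub k)) =
      LinearMap.ker (F.differences ε k) := by
  have hG := F.mergeTree_isMergeForest 0
  ext f
  rw [Submodule.submoduleOf, Submodule.mem_comap, LinearMap.mem_ker]
  constructor
  · rintro ⟨c, hc⟩
    funext i h
    obtain ⟨v, -, hv⟩ := F.exists_extendByZero_eq (hG.source_mem _ (ε i).2) h.down.2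
    obtain ⟨w, -, hw⟩ := F.exists_extendByZero_eq (hG.target_mem _ (ε i).2)
      (F.lt_target (ε i).2 h.down.2)
    rw [differences_apply, hv, hw]
    refine sub_eq_zero.mpr ?_
    exact (congrFun hc v).symm.trans (congrFun hc w)
  · intro hf
    refine ⟨F.extendByZero k f.1 (CellIndex.infty K), ?_⟩
    ext v
    rw [← F.extendByZero_eq_infty ε hf (F.vertexIndex v.1) ⟨v.1, rfl⟩ ((F.mem_sub _ _ _).mp v.2)]
    exact F.extendByZero_vertexIndex f.1 v

theorem differences_surjective (k : Fin (K + 1)) : Function.Surjective (F.differences ε k) := by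
  classical
  have hG := F.mergeTree_isMergeForest 0
  intro c
  -- The value `0` off the live intervals is what makes `g` a cocycle along edges with label above
  -- `k`. Edges with source outside `Y_k` play no role there.
  let d : Fin p → ZMod 2 := fun i =>
    if h : (ε i).1.label ≤ k ∧ (k : WithTop (Fin (K + 1))) < (ε i).1.source.1 then c i ⟨h⟩ else 0
  obtain ⟨g, hg⟩ := hG.exists_sub_eq fun e =>
    if he : e ∈ (F.mergeTree 0).edges then d (ε.symm ⟨e, he⟩) else 0
  have hd : ∀ i, g (ε i).1.source - g (ε i).1.target = d i := fun i => by
    rw [hg _ (ε i).2, dif_pos (ε i).2, Subtype.coe_eta, Equiv.symm_apply_apply]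
  refine ⟨⟨fun v => g (F.vertexIndex v.1), F.mem_cocycle_of_mergeTree fun e he hk => ?_⟩, ?_⟩
  · obtain ⟨i, rfl⟩ : ∃ i, (ε i).1 = e := ⟨ε.symm ⟨e, he⟩, by rw [Equiv.apply_symm_apply]⟩
    exact sub_eq_zero.mp ((hd i).trans (dif_neg fun h => absurd h.1 (not_le.mpr hk)))
  · funext i h
    obtain ⟨v, hv', hv⟩ := F.exists_extendByZero_eq (hG.source_mem _ (ε i).2) h.down.2
    obtain ⟨w, hw', hw⟩ := F.exists_extendByZero_eq (hG.target_mem _ (ε i).2)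
      (F.lt_target (ε i).2 h.down.2)
    have h1 : g (F.vertexIndex v.1) - g (F.vertexIndex w.1) = d i := by rw [hv', hw', hd]
    rw [differences_apply, hv, hw]
    exact h1.trans (dif_pos h.down)

theorem isomorphic_edgeIntervals :
    F.reducedPersistentCohomology.Isomorphic (F.edgeIntervals ε) := by
  have hG := F.mergeTree_isMergeForest 0
  refine ⟨fun k => (Submodule.quotEquivOfEq _ _ (F.ker_differences ε k)).trans
    ((F.differences ε k).quotKerEquivOfSurjective (F.differences_surjective ε k)), ?_⟩
  intro s t h x
  obtain ⟨f, rfl⟩ := Submodule.Quotient.mk_surjective _ x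
  funext i ht
  refine Eq.trans ?_ (PersistenceModule.directSum_interval_map_apply
    (fun i => (ε i).1.label) (fun i => (ε i).1.source.1) h _ i ht).symm
  have hs : (s : WithTop (Fin (K + 1))) < (ε i).1.source.1 :=
    lt_of_le_of_lt (WithTop.coe_le_coe.mpr h) ht.down.2
  have h1 : F.extendByZero t (restrictCochain (F.sub_anti h) f.1) (ε i).1.source -
        F.extendByZero t (restrictCochain (F.sub_anti h) f.1) (ε i).1.target =
      F.extendByZero s f.1 (ε i).1.source - F.extendByZero s f.1 (ε i).1.target := by
    rw [F.extendByZero_restrict h _ (hG.source_mem _ (ε i).2) ht.down.2,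
      F.extendByZero_restrict h _ (hG.target_mem _ (ε i).2) (F.lt_target (ε i).2 ht.down.2)]
  refine Eq.trans h1 ?_
  -- An interval alive at `t` but not at `s` is born after `s`. Its edge has label above `s`, so the
  -- cocycle on `Y_s` has zero difference along it, matching the zero structure map.
  split_ifs with h2
  · rfl
  · refine sub_eq_zero.mpr (F.extendByZero_source_eq f.2 (ε i).2 ?_)
    exact not_le.mp fun h3 => h2 ⟨h3, hs⟩

end Coordinates

open Classical in
/-- The edges of the merge tree give a persistence diagram. -/
theorem isDiagram_mergeTree : F.reducedPersistentCohomology.IsDiagram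
    ((F.mergeTree 0).edges.image fun e => (e.label, e.source.1)).val := by
  have hG := F.mergeTree_isMergeForest 0
  let ε := (F.mergeTree 0).edges.equivFin.symm
  refine ⟨_, fun i => (ε i).1.label, fun i => (ε i).1.source.1,
    fun i => hG.label_lt_source _ (ε i).2, ?_, F.isomorphic_edgeIntervals ε⟩
  refine (Multiset.Nodup.ext (Finset.nodup _) (Multiset.Nodup.map ?_ Finset.univ.nodup)).mpr ?_
  -- Distinct edges have distinct sources, hence multiplicity one.
  · intro i j hij
    exact ε.injective (Subtype.ext (hG.source_injOn (ε i).2 (ε j).2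
      (Subtype.ext (congrArg Prod.snd hij))))
  · intro x
    simp only [Finset.mem_val, Finset.mem_image, Multiset.mem_map, Finset.mem_univ, true_and]
    constructor
    · rintro ⟨e, he, rfl⟩
      exact ⟨ε.symm ⟨e, he⟩, by rw [Equiv.apply_symm_apply]⟩
    · rintro ⟨i, rfl⟩
      exact ⟨(ε i).1, (ε i).2, rfl⟩

end CellFiltration

end MergeTree

theorem mainTheorem6 {X : Type*} [TopologicalSpace X] [T2Space X] {Y : Set X}
    [Topology.CWComplex Y] {K : ℕ} (F : MergeTree.CellFiltration Y K)
    (D : Multiset (Fin (K + 1) × WithTop (Fin (K + 1)))) :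
    F.reducedPersistentCohomology.IsDiagram D ↔
      D = ((F.mergeTree 0).edges.image fun e => (e.label, e.source.1)).val := by
  have h := F.isDiagram_mergeTree
  constructor
  · intro hD
    convert hD.unique h
  · rintro rfl
    convert h
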